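/- For a finite sequence $(s_1,\dots,s_r)$ of non-zero integers and $N\ge 0$ put $$\zeta_N(s_1,\dots,s_r)=\sum_{N\ge n_1>n_2>\cdots>n_r\ge 1}\ \prod_{i=1}^r \frac{\operatorname{sgn}(s_i)^{n_i}}{n_i^{|s_i|}},\qquad \zeta(s_1,\dots,s_r)=\lim_{N\to\infty}\zeta_N(s_1,\dots,s_r)$$ whenever the limit exists, and for positive integers $s_1,\dots,s_r$ and $0\le x<1$ put $$\mathrm{Li}_{s_1,\dots,s_r}(x)=\sum_{n_1>n_2>\cdots>n_r>0}\frac{x^{n_1}}{n_1^{s_1}\cdots n_r^{s_r}}.$$ Write $\bar 1$ for the entry $-1$ and $\{1\}_d$ for the entry $1$ repeated $d$ times. Then for all integers $m,k\ge 0$ the series $\zeta(\bar 1,\{1\}_m,\bar 1,\{1\}_k)$ converges, as do all the series on the right-hand side below, and $$\zeta(\bar 1,\{1\}_m,\bar 1,\{1\}_k)=\frac{(-1)^{m+k+1}}{k!}\sum_{j=0}^{k}(-1)^j(\ln 2)^{k-j}\,j!\binom{k}{j}\left\{\zeta(m+2,\{1\}_j)-\sum_{l=0}^{m+1}\frac{(\ln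 2)^{m+1-l}}{(m+1-l)!}\,\mathrm{Li}_{l+1,\{1\}_j}\!\left(\tfrac12\right)\right\}.$$ -/

import Mathlib

open Filter Topology

namespace MultiZeta

/-- The tuples `(n_1, …, n_k)` of integers with `N ≥ n_1 > n_2 > ⋯ > n_k ≥ 1`
(`n_1` is `n 0`). For `k = 0` there is exactly one such tuple, the empty one. -/
noncomputable def chains (k N : ℕ) : Finset (Fin k → ℕ) :=
  open Classical in
  (Fintype.piFinset fun _ : Fin k => Finset.Icc 1 N).filter fun n => StrictAnti n

/-- The multiple harmonic number
`ζ_N(s_1, …, s_k) = ∑_{N ≥ n_1 > ⋯ > n_k ≥ 1} ∏_j sgn(s_j)^{n_j} / n_j^{|s_j|}`.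
A barred entry `p̄` is the negative integer `-p`. -/
noncomputable def harmonicSum (s : List ℤ) (N : ℕ) : ℝ :=
  ∑ n ∈ chains s.length N,
    ∏ j : Fin s.length, ((s.get j).sign : ℝ) ^ n j / (n j : ℝ) ^ (s.get j).natAbs

/-- The series defining `ζ(s)` converges, summed in the order of its largest index `n_1`. -/
def ZetaConverges (s : List ℤ) : Prop :=
  ∃ L : ℝ, Tendsto (harmonicSum s) atTop (𝓝 L)

/-- The (alternating) multiple zeta value `ζ(s) = lim_{N → ∞} ζ_N(s)`
(meaningful when `ZetaConverges s`). -/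
noncomputable def zeta (s : List ℤ) : ℝ :=
  limUnder atTop (harmonicSum s)

/-- The partial sums
`∑_{N ≥ n_1 > ⋯ > n_k ≥ 1} x^{n_1} / (n_1^{s_1} ⋯ n_k^{s_k})` of the multiple polylogarithm
(with `x^{n_1}` read as `1` in depth zero). -/
noncomputable def polylogPartial (s : List ℕ) (x : ℝ) (N : ℕ) : ℝ :=
  ∑ n ∈ chains s.length N,
    x ^ (if h : 0 < s.length then n ⟨0, h⟩ else 0) /
      ∏ j : Fin s.length, (n j : ℝ) ^ s.get j

/-- The series defining `Li_s(x)` converges. -/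
def PolylogConverges (s : List ℕ) (x : ℝ) : Prop :=
  ∃ L : ℝ, Tendsto (polylogPartial s x) atTop (𝓝 L)

/-- The multiple polylogarithm `Li_s(x)` (meaningful when `PolylogConverges s x`;
for `0 ≤ x` all terms of the series are nonnegative). -/
noncomputable def polylog (s : List ℕ) (x : ℝ) : ℝ :=
  limUnder atTop (polylogPartial s x)

end MultiZeta

namespace MultiZeta

/-! Attach to each index list the power series in `x ^ n₁`. Prepending an entry `1` integrates
against `dx / (1 - x)`; raising a positive leading entry by one integrates against `dx / x`. Under
`x = 1 - 2 * w` the form `dx / (1 - x)` becomes `-dw / w`, so the series of `{1}_M, -1, {1}_k`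
obeys, up to sign, the same recursion in `M` as polylogarithms in `w`.

For `M = 0` the series is a power of `-log (1 - w) - log 2`, which expands into depth-`j + 1`
logarithm powers (`sub_pow_div_factorial`). Integrating from `w = 1 / 2`, that is `x = 0`, produces
the terms collected in `polylogRemainder`; this is `genSeries_eq_sum_polylogRemainder`. With `M = m
+ 1`, letting `w` tend to `1` from below and applying Abel's theorem on both sides gives the
evaluation. Convergence of the doubly alternating series comes from a summation by parts. -/

/-! ### Recursion on the largest index -/

theorem sum_chains_succ (k N : ℕ) (f : (Fin (k + 1) → ℕ) → ℝ) :
    ∑ n ∈ chains (k + 1) N, f n =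
      ∑ a ∈ Finset.Icc 1 N, ∑ n ∈ chains k (a - 1), f (Fin.cons a n) := by
  rw [Finset.sum_sigma']
  refine Finset.sum_bij' (fun n _ => ⟨n 0, Fin.tail n⟩) (fun p _ => Fin.cons p.1 p.2)
    ?_ ?_ ?_ ?_ ?_
  · intro n hn
    simp only [chains, Finset.mem_filter, Fintype.mem_piFinset, Finset.mem_Icc,
      Finset.mem_sigma] at hn ⊢
    refine ⟨hn.1 0, fun i => ⟨(hn.1 i.succ).1, ?_⟩, fun i j hij => hn.2 (Fin.succ_lt_succ_iff.2 hij)⟩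
    have := hn.2 (Fin.succ_pos i)
    simp only [Fin.tail]
    omega
  · rintro ⟨a, n⟩ hn
    simp only [chains, Finset.mem_filter, Fintype.mem_piFinset, Finset.mem_Icc,
      Finset.mem_sigma] at hn ⊢
    obtain ⟨ha, hn, hs⟩ := hn
    refine ⟨fun i => ?_, fun i j hij => ?_⟩
    · refine Fin.cases ?_ (fun i => ?_) i
      · simpa using ha
      · have := hn i
        simp only [Fin.cons_succ]
        omega
    · induction i using Fin.cases with
      | zero =>
        induction j using Fin.cases with
        | zero => exact absurd hij (lt_irrefl _)
        | succ j =>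
          have := hn j
          simp only [Fin.cons_succ, Fin.cons_zero]
          omega
      | succ i =>
        induction j using Fin.cases with
        | zero => exact absurd hij (Fin.not_lt_zero _)
        | succ j => simpa using hs (Fin.succ_lt_succ_iff.1 hij)
  · intro n _
    exact Fin.cons_self_tail n
  · rintro ⟨a, n⟩ _
    simp
  · intro n _
    exact congrArg f (Fin.cons_self_tail n).symm

theorem sum_chains_zero (N : ℕ) (f : (Fin 0 → ℕ) → ℝ) :
    ∑ n ∈ chains 0 N, f n = f Fin.elim0 := by
  have : chains 0 N = {Fin.elim0} := by
    ext n
    simp only [chains, Finset.mem_filter, Fintype.mem_piFinset, Finset.mem_singleton]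
    exact ⟨fun _ => Subsingleton.elim _ _, fun _ => ⟨fun i => i.elim0, fun i => i.elim0⟩⟩
  rw [this, Finset.sum_singleton]

theorem harmonicSum_nil (N : ℕ) : harmonicSum [] N = 1 := by
  unfold harmonicSum
  change ∑ n ∈ chains 0 N, ∏ j : Fin 0, _ = _
  rw [sum_chains_zero]
  simp

theorem harmonicSum_cons (s : ℤ) (t : List ℤ) (N : ℕ) :
    harmonicSum (s :: t) N =
      ∑ n ∈ Finset.Icc 1 N, (s.sign : ℝ) ^ n / (n : ℝ) ^ s.natAbs * harmonicSum t (n - 1) := by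
  unfold harmonicSum
  change ∑ n ∈ chains (t.length + 1) N, ∏ j : Fin (t.length + 1), _ = _
  rw [sum_chains_succ]
  refine Finset.sum_congr rfl fun a _ => ?_
  rw [Finset.mul_sum]
  refine Finset.sum_congr rfl fun n _ => ?_
  rw [Fin.prod_univ_succ]
  rfl

/-- Only `n₁` carries a power of `x`, so the tail is evaluated at `1`. -/
theorem polylogPartial_cons (s : ℕ) (t : List ℕ) (x : ℝ) (N : ℕ) :
    polylogPartial (s :: t) x N =
      ∑ n ∈ Finset.Icc 1 N, x ^ n / (n : ℝ) ^ s * polylogPartial t 1 (n - 1) := by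
  unfold polylogPartial
  change ∑ n ∈ chains (t.length + 1) N, _ / ∏ j : Fin (t.length + 1), _ = _
  rw [sum_chains_succ]
  refine Finset.sum_congr rfl fun a _ => ?_
  rw [Finset.mul_sum]
  refine Finset.sum_congr rfl fun n _ => ?_
  rw [Fin.prod_univ_succ, one_pow, div_mul_div_comm, mul_one]
  simp

theorem polylogPartial_one (t : List ℕ) (ht : ∀ p ∈ t, 0 < p) (N : ℕ) :
    polylogPartial t 1 N = harmonicSum (t.map (fun p : ℕ => (p : ℤ))) N := by
  induction t generalizing N with
  | nil =>
    rw [List.map_nil, harmonicSum_nil]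
    unfold polylogPartial
    change ∑ n ∈ chains 0 N, _ / ∏ j : Fin 0, _ = _
    rw [sum_chains_zero]
    simp
  | cons s t ih =>
    have hs : 0 < s := ht s (by simp)
    rw [List.map_cons, harmonicSum_cons, polylogPartial_cons]
    refine Finset.sum_congr rfl fun n _ => ?_
    rw [ih fun p hp => ht p (by simp [hp])]
    simp [Int.sign_natCast_of_ne_zero hs.ne']

/-! ### Coefficients and their partial sums -/

/-- The coefficients of the generating series `∑ x ^ n₁ ∏ sgn (s_i) ^ n_i / n_i ^ |s_i|`. -/
noncomputable def coeff : List ℤ → ℕ → ℝ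
  | [], n => if n = 0 then 1 else 0
  | s :: t, n => (s.sign : ℝ) ^ n / (n : ℝ) ^ s.natAbs * harmonicSum t (n - 1)

/-- The convention `1 / 0 = 0` makes the spurious index `0` harmless. -/
theorem coeff_cons_zero {s : ℤ} (hs : s ≠ 0) (t : List ℤ) : coeff (s :: t) 0 = 0 := by
  simp [coeff, hs]

theorem coeff_cons_succ (s : ℤ) (t : List ℤ) (n : ℕ) :
    coeff (s :: t) (n + 1) =
      (s.sign : ℝ) ^ (n + 1) / ((n : ℝ) + 1) ^ s.natAbs * harmonicSum t n := by
  simp [coeff]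

theorem sum_Icc_one_eq_sum_range (f : ℕ → ℝ) (h : f 0 = 0) (N : ℕ) :
    ∑ n ∈ Finset.Icc 1 N, f n = ∑ n ∈ Finset.range (N + 1), f n := by
  rw [Finset.sum_range_succ', h, add_zero, Finset.range_eq_Ico, Finset.sum_Ico_add' f 0 N 1]
  rfl

theorem harmonicSum_eq_sum_coeff {s : List ℤ} (hs : ∀ p ∈ s, p ≠ 0) (N : ℕ) :
    harmonicSum s N = ∑ n ∈ Finset.range (N + 1), coeff s n := by
  cases s with
  | nil => simp [harmonicSum_nil, coeff]
  | cons s t =>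
    rw [harmonicSum_cons, ← sum_Icc_one_eq_sum_range _ (coeff_cons_zero (hs s (by simp)) t)]
    rfl

theorem polylogPartial_eq_sum_coeff {s : ℕ} (hs : 0 < s) (t : List ℕ) (ht : ∀ p ∈ t, 0 < p)
    (x : ℝ) (N : ℕ) :
    polylogPartial (s :: t) x N =
      ∑ n ∈ Finset.range (N + 1), coeff ((s :: t).map (fun p : ℕ => (p : ℤ))) n * x ^ n := by
  rw [polylogPartial_cons, List.map_cons, ← sum_Icc_one_eq_sum_range]
  · refine Finset.sum_congr rfl fun n _ => ?_
    rw [polylogPartial_one t ht, coeff, Int.sign_natCast_of_ne_zero hs.ne', Int.natAbs_natCast]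
    push_cast
    ring
  · rw [coeff_cons_zero (by exact_mod_cast hs.ne'), zero_mul]

theorem coeff_neg_one_cons (t : List ℤ) (n : ℕ) :
    coeff (-1 :: t) n = coeff (1 :: t) n * (-1) ^ n := by
  simp [coeff]
  ring

/-! ### Growth of the coefficients -/

theorem abs_harmonicSum_le {s : List ℤ} (hs : ∀ p ∈ s, p ≠ 0) (N : ℕ) :
    |harmonicSum s N| ≤ (1 + Real.log (N + 1)) ^ s.length := by
  induction s generalizing N with
  | nil => simp [harmonicSum_nil]
  | cons s t ih =>
    rw [harmonicSum_cons]
    have hl : ∀ n : ℕ, 0 ≤ Real.log ((n : ℝ) + 1) := fun n => by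
      apply Real.log_nonneg; linarith [(Nat.cast_nonneg n : (0 : ℝ) ≤ n)]
    have hterm : ∀ n ∈ Finset.Icc 1 N,
        |(s.sign : ℝ) ^ n / (n : ℝ) ^ s.natAbs * harmonicSum t (n - 1)| ≤
          (n : ℝ)⁻¹ * (1 + Real.log (N + 1)) ^ t.length := by
      intro n hn
      obtain ⟨h1, h2⟩ := Finset.mem_Icc.1 hn
      have hn1 : (1 : ℝ) ≤ n := by exact_mod_cast h1
      have hs0 : s ≠ 0 := hs s (by simp)
      have hsgn : |(s.sign : ℝ)| = 1 := by
        rcases lt_or_gt_of_ne hs0 with h | h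
        · simp [Int.sign_eq_neg_one_of_neg h]
        · simp [Int.sign_eq_one_of_pos h]
      rw [abs_mul, abs_div, abs_pow, hsgn, one_pow, abs_of_nonneg (by positivity), one_div]
      gcongr
      · exact le_self_pow₀ hn1 (by simpa using hs0)
      · refine (ih (fun p hp => hs p (by simp [hp])) _).trans ?_
        have := hl (n - 1)
        gcongr
        omega
    refine (Finset.abs_sum_le_sum_abs _ _).trans ((Finset.sum_le_sum hterm).trans ?_)
    rw [← Finset.sum_mul, List.length_cons, pow_succ']
    have h0 := hl N
    gcongr
    have := harmonic_le_one_add_log N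
    rw [harmonic_eq_sum_Icc] at this
    push_cast at this
    refine this.trans ?_
    rcases Nat.eq_zero_or_pos N with rfl | hN
    · simp
    · gcongr
      linarith

/-- Powers of logarithms are absorbed by a square root: still negligible against `N`, and summable
against `N ^ 2`. -/
theorem exists_abs_harmonicSum_le {s : List ℤ} (hs : ∀ p ∈ s, p ≠ 0) :
    ∃ C : ℝ, 0 ≤ C ∧ ∀ N : ℕ, |harmonicSum s N| ≤ C * √((N : ℝ) + 1) := by
  have h1 : (fun x : ℝ => 1 + Real.log x) =O[atTop] Real.log :=
    (Asymptotics.IsLittleO.isBigO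
      (Real.isLittleO_const_log_atTop)).add (Asymptotics.isBigO_refl _ _)
  have h2 : (fun x : ℝ => (1 + Real.log x) ^ s.length) =O[atTop] fun x => x ^ (1 / 2 : ℝ) := by
    refine (h1.pow s.length).trans ?_
    have := isLittleO_log_rpow_rpow_atTop (s.length : ℝ) (show (0 : ℝ) < 1 / 2 by norm_num)
    simpa using this.isBigO
  have h3 : Tendsto (fun N : ℕ => (N : ℝ) + 1) atTop atTop :=
    tendsto_atTop_add_const_right _ _ tendsto_natCast_atTop_atTop
  have h4 := h2.comp_tendsto h3
  obtain ⟨C, hC, hb⟩ := Asymptotics.bound_of_isBigO_nat_atTop h4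
  refine ⟨C, hC.le, fun N => (abs_harmonicSum_le hs N).trans ?_⟩
  have hN : (0 : ℝ) < (N : ℝ) + 1 := by positivity
  have := hb (x := N) (by simp only [Function.comp]; positivity)
  simp only [Function.comp, Real.norm_eq_abs] at this
  rw [← Real.sqrt_eq_rpow, abs_of_nonneg (Real.sqrt_nonneg _)] at this
  exact (le_abs_self _).trans this

theorem abs_coeff_cons_succ_le {s : ℤ} (hs : s ≠ 0) (t : List ℤ) (n : ℕ) :
    |coeff (s :: t) (n + 1)| = |harmonicSum t n| / ((n : ℝ) + 1) ^ s.natAbs := by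
  have hsgn : |(s.sign : ℝ)| = 1 := by
    rcases lt_or_gt_of_ne hs with h | h
    · simp [Int.sign_eq_neg_one_of_neg h]
    · simp [Int.sign_eq_one_of_pos h]
  rw [coeff_cons_succ, abs_mul, abs_div, abs_pow, hsgn, one_pow,
    abs_of_nonneg (by positivity : (0 : ℝ) ≤ ((n : ℝ) + 1) ^ s.natAbs)]
  ring

theorem exists_abs_coeff_succ_le {s : List ℤ} (hs : ∀ p ∈ s, p ≠ 0) :
    ∃ C : ℝ, 0 ≤ C ∧ ∀ n : ℕ, |coeff s (n + 1)| ≤ C * √((n : ℝ) + 1) / ((n : ℝ) + 1) := by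
  cases s with
  | nil => exact ⟨0, le_rfl, fun n => by simp [coeff]⟩
  | cons s t =>
    obtain ⟨C, hC, h⟩ := exists_abs_harmonicSum_le fun p hp => hs p (List.mem_cons_of_mem s hp)
    have hs0 : s ≠ 0 := hs s (by simp)
    refine ⟨C, hC, fun n => ?_⟩
    rw [abs_coeff_cons_succ_le hs0]
    gcongr
    · exact h n
    · exact le_self_pow₀ (by linarith [(Nat.cast_nonneg n : (0 : ℝ) ≤ n)]) (by simpa using hs0)

theorem exists_abs_coeff_le {s : List ℤ} (hs : ∀ p ∈ s, p ≠ 0) :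
    ∃ C : ℝ, 0 ≤ C ∧ ∀ n : ℕ, |coeff s n| ≤ C := by
  obtain ⟨C, hC, h⟩ := exists_abs_coeff_succ_le hs
  refine ⟨max C |coeff s 0|, le_max_of_le_left hC, fun n => ?_⟩
  cases n with
  | zero => exact le_max_right _ _
  | succ n =>
    refine le_max_of_le_left ((h n).trans ?_)
    rw [div_le_iff₀ (by positivity)]
    gcongr
    have : (1 : ℝ) ≤ (n : ℝ) + 1 := by linarith [(Nat.cast_nonneg n : (0 : ℝ) ≤ n)]
    exact Real.sqrt_le_iff.2 ⟨by positivity, by nlinarith⟩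

/-! ### Convergence -/

theorem summable_sqrt_div_sq : Summable fun n : ℕ => √((n : ℝ) + 1) / ((n : ℝ) + 1) ^ 2 := by
  have h := (summable_nat_add_iff 1).2
    (Real.summable_nat_rpow.2 (show (-(3 / 2) : ℝ) < -1 by norm_num))
  refine h.congr fun n => ?_
  have hn : (0 : ℝ) < (n : ℝ) + 1 := by positivity
  rw [Real.sqrt_eq_rpow, ← Real.rpow_natCast ((n : ℝ) + 1) 2, ← Real.rpow_sub hn]
  push_cast
  norm_num

theorem tendsto_sqrt_div : Tendsto (fun n : ℕ => √((n : ℝ) + 1) / ((n : ℝ) + 1)) atTop (𝓝 0) := by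
  have h : Tendsto (fun n : ℕ => (√((n : ℝ) + 1))⁻¹) atTop (𝓝 0) :=
    (Real.tendsto_sqrt_atTop.comp
      (tendsto_atTop_add_const_right _ _ tendsto_natCast_atTop_atTop)).inv_tendsto_atTop
  refine h.congr fun n => ?_
  rw [Real.sqrt_div_self']
  simp

/-- Summation by parts: bounded variation replaces the monotonicity of Leibniz's test. -/
theorem exists_tendsto_alternating {c : ℕ → ℝ} (h0 : Tendsto c atTop (𝓝 0))
    (hd : Summable fun n => |c (n + 1) - c n|) :
    ∃ L, Tendsto (fun N => ∑ n ∈ Finset.range N, (-1) ^ n * c n) atTop (𝓝 L) := by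
  have hs : Summable fun n => (-1 : ℝ) ^ n * (c (n + 1) - c n) := by
    refine Summable.of_abs (hd.congr fun n => ?_)
    simp [abs_mul]
  have key : ∀ N, ∑ n ∈ Finset.range N, (-1) ^ n * c n =
      (c 0 - (-1) ^ N * c N - ∑ n ∈ Finset.range N, (-1 : ℝ) ^ n * (c (n + 1) - c n)) / 2 := by
    intro N
    induction N with
    | zero => simp
    | succ N ih =>
      rw [Finset.sum_range_succ, Finset.sum_range_succ, ih]
      ring
  have hb : Tendsto (fun N => (-1 : ℝ) ^ N * c N) atTop (𝓝 0) := by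
    rw [tendsto_zero_iff_abs_tendsto_zero] at h0 ⊢
    refine h0.congr fun n => ?_
    simp [abs_mul]
  simp_rw [key]
  exact ⟨_, ((tendsto_const_nhds.sub hb).sub hs.hasSum.tendsto_sum_nat).div_const 2⟩

/-- The sums over `t` need not be monotone, but the increments of `harmonicSum t n / (n + 1)` are
`O(n ^ (-3 / 2))`. -/
theorem exists_tendsto_sum_coeff_neg_one_cons {t : List ℤ} (ht : ∀ p ∈ t, p ≠ 0) :
    ∃ L, Tendsto (fun N => ∑ n ∈ Finset.range N, coeff (-1 :: t) n) atTop (𝓝 L) := by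
  obtain ⟨C, hC, hb⟩ := exists_abs_harmonicSum_le ht
  obtain ⟨D, hD, hc⟩ := exists_abs_coeff_succ_le ht
  obtain ⟨L, hL⟩ := exists_tendsto_alternating (c := fun n => harmonicSum t n / ((n : ℝ) + 1))
    (by
      refine squeeze_zero_norm (a := fun n : ℕ => C * (√((n : ℝ) + 1) / ((n : ℝ) + 1)))
        (fun n => ?_) (by simpa using tendsto_sqrt_div.const_mul C)
      rw [Real.norm_eq_abs, abs_div, abs_of_nonneg (by positivity : (0 : ℝ) ≤ (n : ℝ) + 1),
        ← mul_div_assoc]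
      gcongr
      exact hb n)
    (by
      refine Summable.of_nonneg_of_le (fun n => abs_nonneg _) (fun n => ?_)
        (summable_sqrt_div_sq.mul_left (D + C))
      have hn : (0 : ℝ) < (n : ℝ) + 1 := by positivity
      have hn2 : (0 : ℝ) < (n : ℝ) + 2 := by positivity
      have hstep : harmonicSum t (n + 1) = harmonicSum t n + coeff t (n + 1) := by
        rw [harmonicSum_eq_sum_coeff ht, harmonicSum_eq_sum_coeff ht, Finset.sum_range_succ]
      have e : harmonicSum t (n + 1) / (((n + 1 : ℕ) : ℝ) + 1) - harmonicSum t n / ((n : ℝ) + 1) =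
          coeff t (n + 1) / ((n : ℝ) + 2) - harmonicSum t n / (((n : ℝ) + 1) * ((n : ℝ) + 2)) := by
        rw [hstep]
        push_cast
        rw [show (n : ℝ) + 1 + 1 = n + 2 by ring]
        field_simp
        ring
      simp only [e]
      refine (abs_sub _ _).trans ?_
      rw [abs_div, abs_div, abs_of_pos hn2, abs_of_pos (mul_pos hn hn2)]
      calc |coeff t (n + 1)| / ((n : ℝ) + 2) + |harmonicSum t n| / (((n : ℝ) + 1) * ((n : ℝ) + 2))
          ≤ D * √((n : ℝ) + 1) / ((n : ℝ) + 1) / ((n : ℝ) + 1) +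
            C * √((n : ℝ) + 1) / (((n : ℝ) + 1) * ((n : ℝ) + 1)) := by
            gcongr
            · exact hc n
            · linarith
            · exact hb n
            · linarith
        _ = (D + C) * (√((n : ℝ) + 1) / ((n : ℝ) + 1) ^ 2) := by
            field_simp)
  -- The term of index `n + 1` has sign `(-1) ^ (n + 1)`, hence `-L`.
  refine ⟨-L, (tendsto_add_atTop_iff_nat 1).1 (hL.neg.congr fun N => ?_)⟩
  rw [Finset.sum_range_succ', coeff_cons_zero (by norm_num), add_zero, ← Finset.sum_neg_distrib]
  refine Finset.sum_congr rfl fun n _ => ?_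
  rw [coeff_cons_succ]
  simp [pow_succ]
  ring

theorem summable_coeff_cons {s : ℤ} (hs : 2 ≤ s.natAbs) {t : List ℤ} (ht : ∀ p ∈ t, p ≠ 0) :
    Summable (coeff (s :: t)) := by
  obtain ⟨C, hC, hb⟩ := exists_abs_harmonicSum_le ht
  rw [← summable_nat_add_iff 1]
  refine Summable.of_norm_bounded (summable_sqrt_div_sq.mul_left C) fun n => ?_
  rw [Real.norm_eq_abs, abs_coeff_cons_succ_le (by omega), ← mul_div_assoc]
  gcongr
  · exact hb n
  · linarith [(Nat.cast_nonneg n : (0 : ℝ) ≤ n)]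

/-! ### Power series with bounded coefficients -/

theorem summable_mul_pow_of_abs_le {a : ℕ → ℝ} {C : ℝ} (ha : ∀ n, |a n| ≤ C) {x : ℝ}
    (hx : |x| < 1) : Summable fun n => |a n * x ^ n| := by
  refine Summable.of_nonneg_of_le (fun n => abs_nonneg _) (fun n => ?_)
    ((summable_geometric_of_lt_one (abs_nonneg x) hx).mul_left C)
  rw [abs_mul, abs_pow]
  gcongr
  exact ha n

theorem hasDerivAt_tsum_mul_pow {a : ℕ → ℝ} {C : ℝ} (ha : ∀ n, |a n| ≤ C) {x : ℝ}
    (hx : |x| < 1) :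
    -- Termwise differentiation, dominated on a ball whose radius lies strictly between `|x|` and
    -- `1`.
    HasDerivAt (fun y => ∑' n, a n * y ^ n) (∑' n : ℕ, ((n : ℝ) + 1) * a (n + 1) * x ^ n) x := by
  obtain ⟨r, hxr, hr⟩ := exists_between hx
  have hr0 : 0 ≤ r := (abs_nonneg x).trans hxr.le
  have hC : 0 ≤ C := (abs_nonneg _).trans (ha 0)
  have hu : Summable fun n : ℕ => C * ((n : ℝ) * r ^ (n - 1)) := by
    refine Summable.mul_left C ((summable_nat_add_iff 1).1 ?_)
    have h1 := summable_pow_mul_geometric_of_norm_lt_one (R := ℝ) 1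
      (by rwa [Real.norm_eq_abs, abs_of_nonneg hr0] : ‖r‖ < 1)
    refine (h1.add (summable_geometric_of_lt_one hr0 hr)).congr fun n => ?_
    simp only [Nat.add_sub_cancel, pow_one]
    push_cast
    ring
  have hb : ∀ (n : ℕ) (y : ℝ), y ∈ Metric.ball (0 : ℝ) r →
      ‖a n * ((n : ℝ) * y ^ (n - 1))‖ ≤ C * ((n : ℝ) * r ^ (n - 1)) := by
    intro n y hy
    have hy' : |y| ≤ r := by
      rw [mem_ball_zero_iff, Real.norm_eq_abs] at hy
      exact hy.le
    rw [Real.norm_eq_abs, abs_mul, abs_mul, abs_pow, Nat.abs_cast]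
    gcongr
    exact ha n
  have hxb : x ∈ Metric.ball (0 : ℝ) r := by simpa using hxr
  have h := hasDerivAt_tsum_of_isPreconnected hu Metric.isOpen_ball
    (convex_ball (0 : ℝ) r).isPreconnected (g := fun n y => a n * y ^ n)
    (g' := fun n y => a n * ((n : ℝ) * y ^ (n - 1)))
    (fun n y _ => (hasDerivAt_pow n y).const_mul (a n)) hb hxb
    (summable_mul_pow_of_abs_le ha hx).of_abs hxb
  have hs : Summable fun n : ℕ => a n * ((n : ℝ) * x ^ (n - 1)) :=
    Summable.of_norm_bounded hu fun n => hb n x hxb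
  rw [hs.tsum_eq_zero_add] at h
  refine h.congr_deriv ?_
  simp only [Nat.cast_zero, zero_mul, mul_zero, zero_add]
  refine tsum_congr fun n => ?_
  simp only [Nat.add_sub_cancel]
  push_cast
  ring

theorem eq_of_hasDerivAt_Ioo {f g f' : ℝ → ℝ} {a b x₀ x : ℝ}
    (hf : ∀ y ∈ Set.Ioo a b, HasDerivAt f (f' y) y) (hg : ∀ y ∈ Set.Ioo a b, HasDerivAt g (f' y) y)
    (hx₀ : x₀ ∈ Set.Ioo a b) (h₀ : f x₀ = g x₀) (hx : x ∈ Set.Ioo a b) : f x = g x :=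
  isOpen_Ioo.eqOn_of_deriv_eq isPreconnected_Ioo
    (fun y hy => (hf y hy).differentiableAt.differentiableWithinAt)
    (fun y hy => (hg y hy).differentiableAt.differentiableWithinAt)
    (fun y hy => (hf y hy).deriv.trans (hg y hy).deriv.symm) hx₀ h₀ hx

/-! ### Generating series -/

/-- The generating series `∑ x ^ n₁ ∏ sgn (s_i) ^ n_i / n_i ^ |s_i|`. -/
noncomputable def genSeries (s : List ℤ) (x : ℝ) : ℝ :=
  ∑' n, coeff s n * x ^ n

theorem genSeries_nil (x : ℝ) : genSeries [] x = 1 := by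
  unfold genSeries
  rw [tsum_eq_single 0 fun n hn => by simp [coeff, hn]]
  simp [coeff]

theorem genSeries_cons_at_zero {s : ℤ} (hs : s ≠ 0) (t : List ℤ) : genSeries (s :: t) 0 = 0 := by
  unfold genSeries
  rw [tsum_eq_single 0 fun n hn => by simp [hn], coeff_cons_zero hs, zero_mul]

theorem genSeries_neg_one_cons (t : List ℤ) (x : ℝ) :
    genSeries (-1 :: t) x = genSeries (1 :: t) (-x) := by
  unfold genSeries
  refine tsum_congr fun n => ?_
  rw [coeff_neg_one_cons, neg_pow x, mul_assoc]

/-- Multiplying by the geometric series replaces coefficients by their partial sums, which are the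
harmonic sums of `t`. -/
theorem hasDerivAt_genSeries_one_cons {t : List ℤ} (ht : ∀ p ∈ t, p ≠ 0) {x : ℝ} (hx : |x| < 1) :
    HasDerivAt (genSeries (1 :: t)) (genSeries t x / (1 - x)) x := by
  obtain ⟨C, -, hC⟩ := exists_abs_coeff_le (s := 1 :: t) (by simpa using ht)
  obtain ⟨D, -, hD⟩ := exists_abs_coeff_le ht
  have h := hasDerivAt_tsum_mul_pow hC hx
  refine h.congr_deriv (Eq.symm ?_)
  have hg : Summable fun n : ℕ => ‖x ^ n‖ := by
    simpa using summable_geometric_of_lt_one (abs_nonneg x) hx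
  rw [div_eq_mul_inv, ← tsum_geometric_of_norm_lt_one (by simpa using hx), genSeries,
    tsum_mul_tsum_eq_tsum_sum_range_of_summable_norm
      (by simpa only [Real.norm_eq_abs] using summable_mul_pow_of_abs_le hD hx) hg]
  refine tsum_congr fun n => ?_
  have hn : (n : ℝ) + 1 ≠ 0 := by positivity
  have e : ((n : ℝ) + 1) * coeff (1 :: t) (n + 1) = harmonicSum t n := by
    rw [coeff_cons_succ]
    simp [hn]
  rw [e, harmonicSum_eq_sum_coeff ht, Finset.sum_mul]
  refine Finset.sum_congr rfl fun i hi => ?_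
  rw [mul_assoc, ← pow_add, Nat.add_sub_cancel' (Finset.mem_range_succ_iff.1 hi)]

theorem hasDerivAt_genSeries_add_two_cons (l : ℕ) {t : List ℤ} (ht : ∀ p ∈ t, p ≠ 0) {x : ℝ}
    (hx : |x| < 1) (hx0 : x ≠ 0) :
    HasDerivAt (genSeries (((l + 2 : ℕ) : ℤ) :: t))
      (genSeries (((l + 1 : ℕ) : ℤ) :: t) x / x) x := by
  have h1 : ((l + 1 : ℕ) : ℤ) ≠ 0 := by positivity
  have h2 : ((l + 2 : ℕ) : ℤ) ≠ 0 := by positivity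
  obtain ⟨C, -, hC⟩ := exists_abs_coeff_le (s := ((l + 2 : ℕ) : ℤ) :: t)
    (List.forall_mem_cons.2 ⟨h2, ht⟩)
  obtain ⟨D, -, hD⟩ := exists_abs_coeff_le (s := ((l + 1 : ℕ) : ℤ) :: t)
    (List.forall_mem_cons.2 ⟨h1, ht⟩)
  have h := hasDerivAt_tsum_mul_pow hC hx
  refine h.congr_deriv (Eq.symm ?_)
  rw [genSeries, (summable_mul_pow_of_abs_le hD hx).of_abs.tsum_eq_zero_add, coeff_cons_zero h1,
    zero_mul, zero_add, div_eq_mul_inv, ← tsum_mul_right]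
  refine tsum_congr fun n => ?_
  have hn : (n : ℝ) + 1 ≠ 0 := by positivity
  rw [coeff_cons_succ, coeff_cons_succ, Int.sign_natCast_of_ne_zero (by omega),
    Int.sign_natCast_of_ne_zero (by omega), Int.natAbs_natCast, Int.natAbs_natCast]
  push_cast
  field_simp
  ring

theorem replicate_one_ne_zero (j : ℕ) : ∀ p ∈ List.replicate j (1 : ℤ), p ≠ 0 := by
  intro p hp
  rw [List.eq_of_mem_replicate hp]
  exact one_ne_zero

theorem replicate_append_neg_one_cons_ne_zero (M k : ℕ) :
    ∀ p ∈ List.replicate M (1 : ℤ) ++ -1 :: List.replicate k 1, p ≠ 0 := by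
  intro p hp
  rcases List.mem_append.1 hp with hp | hp
  · exact replicate_one_ne_zero M p hp
  · rcases List.mem_cons.1 hp with rfl | hp
    · norm_num
    · exact replicate_one_ne_zero k p hp

theorem genSeries_replicate_one (k : ℕ) {x : ℝ} (hx : |x| < 1) :
    genSeries (List.replicate k 1) x = (-Real.log (1 - x)) ^ k / (k.factorial : ℝ) := by
  induction k generalizing x with
  | zero => simp [genSeries_nil]
  | succ k ih =>
    rw [List.replicate_succ]
    refine eq_of_hasDerivAt_Ioo (a := -1) (b := 1) (x₀ := 0)
      (f := genSeries (1 :: List.replicate k 1))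
      (g := fun x => (-Real.log (1 - x)) ^ (k + 1) / ((k + 1).factorial : ℝ))
      (fun y hy => hasDerivAt_genSeries_one_cons (replicate_one_ne_zero k) (abs_lt.2 hy))
      (fun y hy => ?_) (by norm_num) (by simp [genSeries_cons_at_zero]) (abs_lt.1 hx)
    have hy1 : 1 - y ≠ 0 := by linarith [hy.2]
    have h := (((((hasDerivAt_id y).const_sub 1).log hy1).neg).pow (k + 1)).div_const
      ((k + 1).factorial : ℝ)
    refine h.congr_deriv (Eq.symm ?_)
    have hk : (k.factorial : ℝ) ≠ 0 := by positivity
    have hk1 : (k : ℝ) + 1 ≠ 0 := by positivity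
    rw [ih (abs_lt.2 hy), Nat.factorial_succ]
    simp only [id, Nat.add_sub_cancel, Pi.neg_apply]
    push_cast
    field_simp

/-! ### The functional identity behind the evaluation -/

/-- Subtracting from the binomial expansion its value at `a = b`, which is zero, removes the
constant term and leaves differences of powers. -/
theorem sub_pow_div_factorial (a b : ℝ) (k : ℕ) :
    (a - b) ^ (k + 1) / ((k + 1).factorial : ℝ) =
      ∑ j ∈ Finset.range (k + 1),
        (-1 : ℝ) ^ k / (k.factorial : ℝ) * ((-1) ^ j * b ^ (k - j) * (j.factorial : ℝ) *
          (k.choose j : ℝ)) *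
            (a ^ (j + 1) / ((j + 1).factorial : ℝ) - b ^ (j + 1) / ((j + 1).factorial : ℝ)) := by
  have key : ∀ c : ℝ, (c - b) ^ (k + 1) = ∑ j ∈ Finset.range (k + 1),
      c ^ (j + 1) * (-b) ^ (k - j) * ((k + 1).choose (j + 1) : ℝ) + (-b) ^ (k + 1) := by
    intro c
    rw [sub_eq_add_neg, add_pow, Finset.sum_range_succ']
    simp
  have hdiff : (a - b) ^ (k + 1) = ∑ j ∈ Finset.range (k + 1),
      (a ^ (j + 1) - b ^ (j + 1)) * (-b) ^ (k - j) * ((k + 1).choose (j + 1) : ℝ) := by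
    have hb := key b
    rw [sub_self, zero_pow (Nat.succ_ne_zero k)] at hb
    simp only [sub_mul, Finset.sum_sub_distrib]
    linarith [key a]
  rw [hdiff, Finset.sum_div]
  refine Finset.sum_congr rfl fun j hj => ?_
  have hjk : j ≤ k := Finset.mem_range_succ_iff.1 hj
  have hch : ((k : ℝ) + 1) * (k.choose j : ℝ) = ((k + 1).choose (j + 1) : ℝ) * ((j : ℝ) + 1) := by
    exact_mod_cast Nat.add_one_mul_choose_eq k j
  have hsign : (-1 : ℝ) ^ k * (-1) ^ j = (-1) ^ (k - j) := by
    obtain ⟨i, rfl⟩ := Nat.exists_eq_add_of_le hjk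
    rw [Nat.add_sub_cancel_left, pow_add, mul_right_comm, ← mul_pow]
    simp
  have hkf : (k.factorial : ℝ) ≠ 0 := by positivity
  have hjf : (j.factorial : ℝ) ≠ 0 := by positivity
  have hk1 : (k : ℝ) + 1 ≠ 0 := by positivity
  have hj1 : (j : ℝ) + 1 ≠ 0 := by positivity
  rw [neg_pow b, ← hsign, Nat.factorial_succ, Nat.factorial_succ]
  push_cast
  field_simp
  linear_combination -(a ^ (j + 1) - b ^ (j + 1)) * b ^ (k - j) * hch

/-- `Li_{M + 1, {1}_j} (w)` minus the Taylor-like polynomial in `log (2 w)` which makes the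
first `M` iterated `w d/dw`-derivatives vanish at `1 / 2`. -/
noncomputable def polylogRemainder (j M : ℕ) (w : ℝ) : ℝ :=
  genSeries (((M + 1 : ℕ) : ℤ) :: List.replicate j 1) w -
    ∑ l ∈ Finset.range (M + 1), Real.log (2 * w) ^ (M - l) / ((M - l).factorial : ℝ) *
      genSeries (((l + 1 : ℕ) : ℤ) :: List.replicate j 1) (1 / 2)

theorem polylogRemainder_half (j M : ℕ) : polylogRemainder j M (1 / 2) = 0 := by
  unfold polylogRemainder
  rw [Finset.sum_range_succ, Finset.sum_eq_zero]
  · simp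
  · intro l hl
    have : M - l ≠ 0 := by
      have := Finset.mem_range.1 hl
      omega
    simp [this]

theorem polylogRemainder_zero (j : ℕ) {w : ℝ} (hw : |w| < 1) :
    polylogRemainder j 0 w =
      (-Real.log (1 - w)) ^ (j + 1) / ((j + 1).factorial : ℝ) -
        Real.log 2 ^ (j + 1) / ((j + 1).factorial : ℝ) := by
  have h := genSeries_replicate_one (j + 1) hw
  have h' := genSeries_replicate_one (j + 1) (show |(1 / 2 : ℝ)| < 1 by norm_num [abs_of_pos])
  have e : -Real.log (1 - 1 / 2) = Real.log 2 := by
    rw [← Real.log_inv]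
    norm_num
  rw [e] at h'
  rw [List.replicate_succ] at h h'
  simp [polylogRemainder, h, ← h']

theorem hasDerivAt_polylogRemainder_succ (j M : ℕ) {w : ℝ} (hw : w ∈ Set.Ioo (0 : ℝ) 1) :
    HasDerivAt (polylogRemainder j (M + 1)) (polylogRemainder j M w / w) w := by
  have hw0 : w ≠ 0 := hw.1.ne'
  have h1 := hasDerivAt_genSeries_add_two_cons M (replicate_one_ne_zero j)
    (abs_lt.2 ⟨by linarith [hw.1], hw.2⟩) hw0
  have hlog : HasDerivAt (fun w : ℝ => Real.log (2 * w)) (1 / w) w := by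
    have := ((hasDerivAt_id w).const_mul 2).log (by simpa using hw0)
    refine this.congr_deriv ?_
    simp only [id]
    field_simp
  have h2 : HasDerivAt (fun w : ℝ => ∑ l ∈ Finset.range (M + 2),
      Real.log (2 * w) ^ (M + 1 - l) / ((M + 1 - l).factorial : ℝ) *
        genSeries (((l + 1 : ℕ) : ℤ) :: List.replicate j 1) (1 / 2))
      (∑ l ∈ Finset.range (M + 1), (Real.log (2 * w) ^ (M - l) / ((M - l).factorial : ℝ) *
        genSeries (((l + 1 : ℕ) : ℤ) :: List.replicate j 1) (1 / 2)) / w) w := by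
    -- The term `l = M + 1` is constant in `w`; the others each lose one power of the logarithm.
    simp only [Finset.sum_range_succ _ (M + 1), Nat.sub_self, pow_zero]
    refine (HasDerivAt.fun_sum fun l hl => ?_).add_const _
    have hl' : M + 1 - l = M - l + 1 := by
      have := Finset.mem_range.1 hl
      omega
    rw [hl']
    refine (((hlog.fun_pow (M - l + 1)).div_const _).mul_const _).congr_deriv (Eq.symm ?_)
    have hf : ((M - l).factorial : ℝ) ≠ 0 := by positivity
    have hf1 : ((M - l : ℕ) : ℝ) + 1 ≠ 0 := by positivity
    rw [Nat.factorial_succ]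
    simp only [Nat.add_sub_cancel]
    push_cast
    field_simp
  have h := h1.sub h2
  rw [← Finset.sum_div, ← sub_div] at h
  exact h

/-- Induction on `M`: for `M > 0` both sides vanish at `w = 1 / 2`, and `w d/dw` lowers `M` by one
with the same sign `-1`. -/
theorem genSeries_eq_sum_polylogRemainder (k M : ℕ) {w : ℝ} (hw : w ∈ Set.Ioo (0 : ℝ) 1) :
    genSeries (List.replicate M 1 ++ -1 :: List.replicate k 1) (1 - 2 * w) =
      (-1) ^ M * ∑ j ∈ Finset.range (k + 1),
        (-1 : ℝ) ^ k / (k.factorial : ℝ) * ((-1) ^ j * Real.log 2 ^ (k - j) *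
          (j.factorial : ℝ) * (k.choose j : ℝ)) * polylogRemainder j M w := by
  induction M generalizing w with
  | zero =>
    have hw' : |w| < 1 := abs_lt.2 ⟨by linarith [hw.1], hw.2⟩
    have h := genSeries_replicate_one (k + 1) (x := 2 * w - 1)
      (abs_lt.2 ⟨by linarith [hw.1], by linarith [hw.2]⟩)
    rw [List.replicate_succ] at h
    have e : -Real.log (1 - (2 * w - 1)) = -Real.log (1 - w) - Real.log 2 := by
      rw [show 1 - (2 * w - 1) = (1 - w) * 2 by ring,
        Real.log_mul (by linarith [hw.2]) two_ne_zero]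
      ring
    rw [List.replicate_zero, List.nil_append, genSeries_neg_one_cons, neg_sub, h, e, pow_zero,
      one_mul, sub_pow_div_factorial]
    refine Finset.sum_congr rfl fun j _ => ?_
    rw [polylogRemainder_zero j hw']
  | succ M ih =>
    have hne := replicate_append_neg_one_cons_ne_zero M k
    rw [List.replicate_succ, List.cons_append]
    refine eq_of_hasDerivAt_Ioo (a := 0) (b := 1) (x₀ := 1 / 2)
      (f := fun w => genSeries (1 :: (List.replicate M 1 ++ -1 :: List.replicate k 1)) (1 - 2 * w))
      (g := fun w => (-1) ^ (M + 1) * ∑ j ∈ Finset.range (k + 1),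
        (-1 : ℝ) ^ k / (k.factorial : ℝ) * ((-1) ^ j * Real.log 2 ^ (k - j) *
          (j.factorial : ℝ) * (k.choose j : ℝ)) * polylogRemainder j (M + 1) w)
      (fun y hy => ?_)
      (fun y hy => (HasDerivAt.fun_sum fun j _ =>
        (hasDerivAt_polylogRemainder_succ j M hy).const_mul _).const_mul _)
      (by norm_num) ?_ hw
    · have h1 := hasDerivAt_genSeries_one_cons hne (x := 1 - 2 * y)
        (abs_lt.2 ⟨by linarith [hy.2], by linarith [hy.1]⟩)
      have h2 : HasDerivAt (fun y : ℝ => 1 - 2 * y) (-2) y := by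
        simpa using ((hasDerivAt_id y).const_mul 2).const_sub 1
      refine (HasDerivAt.comp y h1 h2).congr_deriv (Eq.symm ?_)
      have hy0 : y ≠ 0 := hy.1.ne'
      simp only [mul_div_assoc', ← Finset.sum_div]
      rw [ih hy, pow_succ, show 1 - (1 - 2 * y) = 2 * y by ring]
      field_simp
    · simp only [polylogRemainder_half, mul_zero, Finset.sum_const_zero]
      norm_num [genSeries_cons_at_zero]

/-! ### Boundary values -/

theorem tendsto_harmonicSum_iff {s : List ℤ} (hs : ∀ p ∈ s, p ≠ 0) {L : ℝ} :
    Tendsto (harmonicSum s) atTop (𝓝 L) ↔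
      Tendsto (fun N => ∑ n ∈ Finset.range N, coeff s n) atTop (𝓝 L) := by
  rw [← tendsto_add_atTop_iff_nat (f := fun N => ∑ n ∈ Finset.range N, coeff s n) 1]
  exact tendsto_congr (harmonicSum_eq_sum_coeff hs)

/-- Abel's limit theorem, which needs only conditional convergence. -/
theorem tendsto_genSeries_zeta {s : List ℤ} (hs : ∀ p ∈ s, p ≠ 0) (h : ZetaConverges s) :
    Tendsto (genSeries s) (𝓝[<] 1) (𝓝 (zeta s)) := by
  obtain ⟨L, hL⟩ := h
  rw [zeta, hL.limUnder_eq]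
  exact Real.tendsto_tsum_powerSeries_nhdsWithin_lt ((tendsto_harmonicSum_iff hs).1 hL)

theorem tendsto_polylogPartial_half (l j : ℕ) :
    Tendsto (polylogPartial ((l + 1) :: List.replicate j 1) (1 / 2)) atTop
      (𝓝 (genSeries (((l + 1 : ℕ) : ℤ) :: List.replicate j 1) (1 / 2))) := by
  obtain ⟨C, -, hC⟩ := exists_abs_coeff_le (s := ((l + 1 : ℕ) : ℤ) :: List.replicate j 1)
    (List.forall_mem_cons.2 ⟨by positivity, replicate_one_ne_zero j⟩)
  have h := (summable_mul_pow_of_abs_le hC (show |(1 / 2 : ℝ)| < 1 by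
    norm_num [abs_of_pos])).of_abs.hasSum.tendsto_sum_nat
  refine ((tendsto_add_atTop_iff_nat 1).2 h).congr fun N => ?_
  rw [polylogPartial_eq_sum_coeff l.succ_pos _ fun p hp => by simp [List.eq_of_mem_replicate hp]]
  simp

end MultiZeta

theorem theorem3p3 (m k : ℕ) :
    MultiZeta.ZetaConverges (-1 :: (List.replicate m 1 ++ -1 :: List.replicate k 1)) ∧
    (∀ j ≤ k, MultiZeta.ZetaConverges (((m + 2 : ℕ) : ℤ) :: List.replicate j 1)) ∧
    (∀ j ≤ k, ∀ l ≤ m + 1,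
      MultiZeta.PolylogConverges ((l + 1) :: List.replicate j 1) (1 / 2)) ∧
    MultiZeta.zeta (-1 :: (List.replicate m 1 ++ -1 :: List.replicate k 1)) =
      (-1 : ℝ) ^ (m + k + 1) / (k.factorial : ℝ) *
        ∑ j ∈ Finset.range (k + 1),
          (-1 : ℝ) ^ j * Real.log 2 ^ (k - j) * (j.factorial : ℝ) * (k.choose j : ℝ) *
            (MultiZeta.zeta (((m + 2 : ℕ) : ℤ) :: List.replicate j 1) -
              ∑ l ∈ Finset.range (m + 2),
                Real.log 2 ^ (m + 1 - l) / ((m + 1 - l).factorial : ℝ) *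
                  MultiZeta.polylog ((l + 1) :: List.replicate j 1) (1 / 2)) := by
  open MultiZeta in
  have hne := replicate_append_neg_one_cons_ne_zero m k
  have hne' : ∀ p ∈ (-1 : ℤ) :: (List.replicate m 1 ++ -1 :: List.replicate k 1), p ≠ 0 :=
    List.forall_mem_cons.2 ⟨by norm_num, hne⟩
  have hnej : ∀ j, ∀ p ∈ ((m + 2 : ℕ) : ℤ) :: List.replicate j 1, p ≠ 0 := fun j =>
    List.forall_mem_cons.2 ⟨by positivity, replicate_one_ne_zero j⟩
  have hconv : ZetaConverges (-1 :: (List.replicate m 1 ++ -1 :: List.replicate k 1)) := by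
    obtain ⟨L, hL⟩ := exists_tendsto_sum_coeff_neg_one_cons hne
    exact ⟨L, (tendsto_harmonicSum_iff hne').2 hL⟩
  have hconvj : ∀ j, ZetaConverges (((m + 2 : ℕ) : ℤ) :: List.replicate j 1) := fun j =>
    ⟨_, (tendsto_harmonicSum_iff (hnej j)).2
      (summable_coeff_cons (by omega) (replicate_one_ne_zero j)).hasSum.tendsto_sum_nat⟩
  refine ⟨hconv, fun j _ => hconvj j, fun j _ l _ => ⟨_, tendsto_polylogPartial_half l j⟩, ?_⟩
  have hpoly : ∀ l j, polylog ((l + 1) :: List.replicate j 1) (1 / 2) =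
      genSeries (((l + 1 : ℕ) : ℤ) :: List.replicate j 1) (1 / 2) := fun l j =>
    (tendsto_polylogPartial_half l j).limUnder_eq
  simp only [hpoly]
  have hlim : Tendsto (fun w : ℝ => 2 * w - 1) (𝓝[<] 1) (𝓝[<] 1) := by
    refine tendsto_nhdsWithin_of_tendsto_nhds_of_eventually_within _ ?_ ?_
    · refine tendsto_nhdsWithin_of_tendsto_nhds ?_
      exact Continuous.tendsto' (by fun_prop) _ _ (by norm_num)
    · filter_upwards [self_mem_nhdsWithin] with w hw
      have : w < 1 := hw
      change 2 * w - 1 < 1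
      linarith
  -- The leading `-1` turns the argument `1 - 2 * w`, tending to `-1`, into `2 * w - 1`, tending to
  -- `1` from below.
  have hleft := (tendsto_genSeries_zeta hne' hconv).comp hlim
  have hlog : Tendsto (fun w : ℝ => Real.log (2 * w)) (𝓝[<] 1) (𝓝 (Real.log 2)) := by
    refine tendsto_nhdsWithin_of_tendsto_nhds ?_
    have : ContinuousAt (fun w : ℝ => Real.log (2 * w)) 1 :=
      ContinuousAt.log (by fun_prop) (by norm_num)
    simpa [ContinuousAt] using this
  have hrem : ∀ j, Tendsto (polylogRemainder j (m + 1)) (𝓝[<] 1)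
      (𝓝 (zeta (((m + 2 : ℕ) : ℤ) :: List.replicate j 1) - ∑ l ∈ Finset.range (m + 2),
        Real.log 2 ^ (m + 1 - l) / ((m + 1 - l).factorial : ℝ) *
          genSeries (((l + 1 : ℕ) : ℤ) :: List.replicate j 1) (1 / 2))) := fun j =>
    (tendsto_genSeries_zeta (hnej j) (hconvj j)).sub
      (tendsto_finsetSum _ fun l _ => ((hlog.pow _).div_const _).mul_const _)
  have hright := (tendsto_finsetSum (Finset.range (k + 1)) fun j _ => (hrem j).const_mul
    ((-1 : ℝ) ^ k / (k.factorial : ℝ) * ((-1) ^ j * Real.log 2 ^ (k - j) *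
      (j.factorial : ℝ) * (k.choose j : ℝ)))).const_mul ((-1 : ℝ) ^ (m + 1))
  refine (tendsto_nhds_unique (hleft.congr' ?_) hright).trans ?_
  · filter_upwards [Ioo_mem_nhdsLT (show (0 : ℝ) < 1 by norm_num)] with w hw
    rw [← genSeries_eq_sum_polylogRemainder k (m + 1) hw, Function.comp, genSeries_neg_one_cons,
      neg_sub, List.replicate_succ, List.cons_append]
  · rw [Finset.mul_sum, Finset.mul_sum]
    refine Finset.sum_congr rfl fun j _ => ?_
    rw [show m + k + 1 = m + 1 + k by ring, pow_add _ (m + 1)]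
    ring
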